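/- Let $\mathcal P$ be the set of Borel probability measures on $[0,1]$ with the topology of weak convergence. For $\mu\in\mathcal P$ let $F_\mu(x-)=\mu([0,x))$ and $$S_\mu=\{(x,y)\in[0,1]^2:\ x\ge F_\mu((1-y)-)\},$$ and let $\mathcal P_{\mathsf s}$ be the set of $\mu\in\mathcal P$ such that $S_\mu$ is symmetric, i.e. $(x,y)\in S_\mu\iff(y,x)\in S_\mu$. A simple graph on a vertex set $V$ is a threshold graph if there are real weights $(w_i)_{i\in V}$ and a real $t$ such that distinct $i,j\in V$ are adjacent if and only if $w_i+w_j>t$. For a finite graph $G$ with $v(G)\ge1$ vertices, let $\nu(G)\in\mathcal P$ be the distribution of $d_G(v)/v(G)$, where $d_G(v)$ is the degree of a uniformly random vertex $v$ of $G$. For a symmetric measurable set $S\subseteq[0,1]^2$ and $n\ge1$, let $T_{n,S}$ be the random graph on $[n]=\{1,\dots,n\}$ in which distinct $i,j$ are adjacent if and only if $(U_i,U_j)\in S$, where $U_1,\dots,U_n$ are independent and uniformly distributed on $[0,1]$. Theorem. Suppose that $(G_n)_{n\ge1}$ is a sequence of random threshold graphs, $G_n$ having vertex set $[n]$, such that for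 every $n\ge1$ the distribution of $G_n$ is invariant under all permutations of $[n]$, and the subgraph of $G_{n+1}$ induced on $[n]$ has the same distribution as $G_n$. (The $G_n$ may be defined on different probability spaces.) Suppose further that $\nu(G_n)\to\mu$ in probability as $n\to\infty$, for some $\mu\in\mathcal P$; that is, $\Pr(\nu(G_n)\in A)\to1$ for every neighbourhood $A$ of $\mu$ in $\mathcal P$. Then $\mu\in\mathcal P_{\mathsf s}$ and, for every $n\ge1$, $G_n$ has the same distribution as $T_{n,S_\mu}$. -/

import Mathlib

open MeasureTheory ProbabilityTheory Filter Topology unitInterval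

noncomputable section

namespace ThresholdLimit

/-- A simple graph is a threshold graph if there are real weights `w` and a threshold `t` such that
two distinct vertices are adjacent iff the sum of their weights exceeds `t`. -/
def IsThreshold {V : Type*} (G : SimpleGraph V) : Prop :=
  ∃ (w : V → ℝ) (t : ℝ), ∀ i j, i ≠ j → (G.Adj i j ↔ t < w i + w j)

open Classical in
/-- The normalized degree `d_G(v) / v(G)`, as an element of `[0,1]`. -/
def normalizedDegree {V : Type*} [Fintype V] (G : SimpleGraph V) (v : V) : I :=
  ⟨(G.degree v : ℝ) / (Fintype.card V : ℝ), by positivity,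
    div_le_one_of_le₀ (by exact_mod_cast (G.degree_lt_card_verts v).le) (by positivity)⟩

/-- The (normalized) degree distribution `ν(G)`: the law of `d_G(v) / v(G)` for a uniformly random
vertex `v` of the finite nonempty graph `G`. -/
def degreeDist {V : Type*} [Fintype V] [Nonempty V] (G : SimpleGraph V) : ProbabilityMeasure I :=
  ⟨((PMF.uniformOfFintype V).map (normalizedDegree G)).toMeasure, inferInstance⟩

/-- The left-continuous distribution function `F_μ(x-) = μ([0,x))`, for `x ∈ [0,1]`. -/
def cdfLeft (μ : ProbabilityMeasure I) (x : I) : ℝ :=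
  (μ : Measure I).real (Set.Iio x)

/-- The closed increasing set `S_μ = {(x,y) ∈ [0,1]² : x ≥ F_μ((1-y)-)}`; here `σ y = 1 - y`. -/
def thresholdSet (μ : ProbabilityMeasure I) : Set (I × I) :=
  {p | cdfLeft μ (σ p.2) ≤ (p.1 : ℝ)}

/-- The set `P_s` of probability measures `μ` on `[0,1]` for which `S_μ` equals its reflection
`S_μ† = {(x,y) : (y,x) ∈ S_μ}` in the main diagonal. -/
def symmetricMeasures : Set (ProbabilityMeasure I) :=
  {μ | Prod.swap ⁻¹' thresholdSet μ = thresholdSet μ}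

/-- The graph on `[n]` with an edge between distinct `i`, `j` when `(u i, u j) ∈ S`
(for symmetric `S`; `fromRel` removes loops and symmetrizes the relation). -/
def pointGraph {n : ℕ} (S : Set (I × I)) (u : Fin n → I) : SimpleGraph (Fin n) :=
  SimpleGraph.fromRel (fun i j => (u i, u j) ∈ S)

/-- The joint law of `n` independent points, each uniform on `[0,1]`. -/
def uniformPoints (n : ℕ) : Measure (Fin n → I) :=
  Measure.pi (fun _ => (volume : Measure I))

/-- Random elements `X n`, possibly defined on different probability spaces, converge in
probability to the constant `a`: each neighbourhood of `a` has probability tending to `1`. -/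
def TendstoInProb {E : Type*} [TopologicalSpace E] {Ω : ℕ → Type*} [∀ n, MeasurableSpace (Ω n)]
    (P : ∀ n, Measure (Ω n)) (X : ∀ n, Ω n → E) (a : E) : Prop :=
  ∀ A ∈ 𝓝 a, Tendsto (fun n => P n {ω | X n ω ∈ A}) atTop (𝓝 1)

end ThresholdLimit

end

open scoped symmDiff ENNReal

noncomputable section

namespace ThresholdLimit

/-! Order the vertices of a threshold graph `H` on `M + 1` vertices by weight. Neighbourhoods become
nested, so degrees determine adjacency for all but few pairs of vertices. Viewed on a grid of cells
of side 1/(M+1), the adjacency set `cellSet H s` differs from `reflectedSet (degreeDist H)` by area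
at most 2/(M+1) (`volume_symmDiff_cellSet_le`). Weak convergence ν → μ makes the area between the
reflected sets vanish (`tendsto_volume_symmDiff_reflectedSet`). Hence if the degree distribution of
a large `H` is close to μ, its adjacency set is close to the reflection of S_μ and, being symmetric,
also to S_μ. So S_μ and its reflection agree up to a null set, and monotonicity with left continuity
upgrades this to equality (`mem_symmetricMeasures_of_volume_eq_zero`).

For the law, fix a graph K on [n]. Exchangeability and consistency make P(G_n = K) equal, up to
n²/(M+1), to the expected density of K in G_{M+1} under sampling with replacement
(`abs_integral_inducedDensity_sub_le`). Sampling vertices amounts to sampling cells of uniform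
points, so that density differs from P(T_{n,S_μ} = K) by at most n² times the area between the
adjacency set and S_μ. Then M → ∞. -/

/-! ### Left distribution functions and the sets S_μ. -/

lemma cdfLeft_nonneg (μ : ProbabilityMeasure I) (x : I) : 0 ≤ cdfLeft μ x := measureReal_nonneg

lemma cdfLeft_le_one (μ : ProbabilityMeasure I) (x : I) : cdfLeft μ x ≤ 1 := measureReal_le_one

lemma cdfLeft_mono (μ : ProbabilityMeasure I) : Monotone (cdfLeft μ) := fun _ _ h =>
  measureReal_mono (Set.Iio_subset_Iio h)

lemma cdfLeft_zero (μ : ProbabilityMeasure I) : cdfLeft μ 0 = 0 := by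
  have : Set.Iio (0 : I) = ∅ := by ext x; simp
  simp [cdfLeft, this]

lemma measurable_cdfLeft (μ : ProbabilityMeasure I) : Measurable (cdfLeft μ) :=
  (cdfLeft_mono μ).measurable

lemma measurableSet_thresholdSet (μ : ProbabilityMeasure I) : MeasurableSet (thresholdSet μ) :=
  measurableSet_le ((measurable_cdfLeft μ).comp (measurable_symm.comp measurable_snd))
    (measurable_subtype_coe.comp measurable_fst)

/-- The reflection of the set `S_μ` in the main diagonal. -/
def reflectedSet (μ : ProbabilityMeasure I) : Set (I × I) := Prod.swap ⁻¹' thresholdSet μ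

lemma mem_reflectedSet {μ : ProbabilityMeasure I} {p : I × I} :
    p ∈ reflectedSet μ ↔ cdfLeft μ (σ p.1) ≤ p.2 := Iff.rfl

lemma mem_thresholdSet {μ : ProbabilityMeasure I} {p : I × I} :
    p ∈ thresholdSet μ ↔ cdfLeft μ (σ p.2) ≤ p.1 := Iff.rfl

lemma measurableSet_reflectedSet (μ : ProbabilityMeasure I) : MeasurableSet (reflectedSet μ) :=
  measurable_swap (measurableSet_thresholdSet μ)

/-! ### Continuity in measure of the reflected set. -/

lemma tendsto_cdfLeft (μ : ProbabilityMeasure I) {s : I} (hs : (μ : Measure I) {s} = 0) :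
    Tendsto (fun ν : ProbabilityMeasure I => cdfLeft ν s) (𝓝 μ) (𝓝 (cdfLeft μ s)) := by
  have h0 : (μ : Measure I) (frontier (Set.Iio s)) = 0 :=
    measure_mono_null (fun x hx => by
      rw [isOpen_Iio.frontier_eq] at hx
      exact le_antisymm (closure_lt_subset_le continuous_id continuous_const hx.1) (not_lt.1 hx.2)) hs
  have := ProbabilityMeasure.tendsto_measure_of_null_frontier_of_tendsto'
    (tendsto_id (x := 𝓝 μ)) h0
  exact (ENNReal.tendsto_toReal (measure_ne_top _ _)).comp this

/-- Convergence can fail only where `σ x` is an atom of μ, and the atoms are countable. -/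
lemma ae_tendsto_cdfLeft_symm (μ : ProbabilityMeasure I) :
    ∀ᵐ x : I, Tendsto (fun ν : ProbabilityMeasure I => cdfLeft ν (σ x)) (𝓝 μ)
      (𝓝 (cdfLeft μ (σ x))) := by
  have hc : Set.Countable {t : I | 0 < (μ : Measure I) {a | id a = t}} :=
    Measure.countable_meas_level_set_pos measurable_id
  have hc' : Set.Countable (σ ⁻¹' {t : I | 0 < (μ : Measure I) {a | id a = t}}) :=
    hc.preimage unitInterval.symm_bijective.injective
  filter_upwards [hc'.ae_notMem volume] with x hx
  refine tendsto_cdfLeft μ ?_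
  simpa using hx

/-- By Fubini: the fibre over x lies between the two values of the distribution functions at `σ x`.
-/
lemma volume_symmDiff_reflectedSet_le (μ ν : ProbabilityMeasure I) :
    volume (reflectedSet ν ∆ reflectedSet μ) ≤
      ∫⁻ x : I, edist (cdfLeft ν (σ x)) (cdfLeft μ (σ x)) := by
  rw [Measure.volume_eq_prod, Measure.prod_apply
    ((measurableSet_reflectedSet ν).symmDiff (measurableSet_reflectedSet μ))]
  refine lintegral_mono fun x => ?_
  let a : I := ⟨cdfLeft ν (σ x), cdfLeft_nonneg _ _, cdfLeft_le_one _ _⟩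
  let b : I := ⟨cdfLeft μ (σ x), cdfLeft_nonneg _ _, cdfLeft_le_one _ _⟩
  have hsub : Prod.mk x ⁻¹' (reflectedSet ν ∆ reflectedSet μ) ⊆ Set.uIcc b a := by
    rintro y (⟨h1, h2⟩ | ⟨h1, h2⟩) <;> rw [mem_reflectedSet] at h1 h2
    · exact Set.Icc_subset_uIcc' ⟨h1, (not_le.1 h2).le⟩
    · exact Set.Icc_subset_uIcc ⟨h1, (not_le.1 h2).le⟩
  refine (measure_mono hsub).trans ?_
  rw [volume_uIcc]
  rfl

lemma tendsto_volume_symmDiff_reflectedSet (μ : ProbabilityMeasure I) :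
    Tendsto (fun ν => volume (reflectedSet ν ∆ reflectedSet μ)) (𝓝 μ) (𝓝 0) := by
  have key : Tendsto (fun ν : ProbabilityMeasure I =>
      ∫⁻ x : I, edist (cdfLeft ν (σ x)) (cdfLeft μ (σ x))) (𝓝 μ) (𝓝 (∫⁻ _ : I, 0)) := by
    -- Dominated convergence along `𝓝 μ` needs a countably generated filter; weak convergence on
    -- [0,1] is metrizable.
    refine tendsto_lintegral_filter_of_dominated_convergence (fun _ => 1) ?_ ?_ ?_ ?_
    · exact .of_forall fun ν => ((measurable_cdfLeft ν).comp measurable_symm).edist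
        ((measurable_cdfLeft μ).comp measurable_symm)
    · refine .of_forall fun ν => .of_forall fun x => ?_
      rw [edist_dist, Real.dist_eq, ENNReal.ofReal_le_one]
      exact abs_sub_le_of_nonneg_of_le (cdfLeft_nonneg _ _) (cdfLeft_le_one _ _)
        (cdfLeft_nonneg _ _) (cdfLeft_le_one _ _)
    · simp
    · filter_upwards [ae_tendsto_cdfLeft_symm μ] with x hx
      exact tendsto_iff_edist_tendsto_0.1 hx
  rw [lintegral_zero] at key
  exact tendsto_of_tendsto_of_tendsto_of_le_of_le tendsto_const_nhds key (fun _ => zero_le)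
    fun ν => volume_symmDiff_reflectedSet_le μ ν

/-! ### From symmetry almost everywhere to symmetry. -/

lemma volume_swap_preimage {S : Set (I × I)} (hS : MeasurableSet S) :
    volume (Prod.swap ⁻¹' S) = volume S :=
  (Measure.measurePreserving_swap (μ := (volume : Measure I)) (ν := (volume : Measure I))
    ).measure_preimage hS.nullMeasurableSet

/-- Left continuity of `F_μ(x-)`. -/
lemma exists_lt_cdfLeft {μ : ProbabilityMeasure I} {s : I} {y : ℝ} (hy : 0 ≤ y)
    (h : y < cdfLeft μ s) : ∃ r < s, y < cdfLeft μ r := by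
  have hs : 0 < s := by
    rcases eq_or_ne s 0 with rfl | h0
    · rw [cdfLeft_zero] at h; exact absurd hy (not_le.2 h)
    · exact unitInterval.pos_iff_ne_zero.2 h0
  obtain ⟨u, hu, hus, hlim⟩ := exists_seq_strictMono_tendsto' hs
  have hU : Set.Iio s = ⋃ k, Set.Iio (u k) := by
    ext z
    simp only [Set.mem_Iio, Set.mem_iUnion]
    exact ⟨fun hz => (hlim.eventually (lt_mem_nhds hz)).exists,
      fun ⟨k, hk⟩ => hk.trans (hus k).2⟩
  have ht : Tendsto (fun k => cdfLeft μ (u k)) atTop (𝓝 (cdfLeft μ s)) := by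
    have := tendsto_measure_iUnion_atTop (μ := (μ : Measure I)) (s := fun k => Set.Iio (u k))
      fun a b hab => Set.Iio_subset_Iio (hu.monotone hab)
    rw [← hU] at this
    exact (ENNReal.tendsto_toReal (measure_ne_top _ _)).comp this
  obtain ⟨k, hk⟩ := (ht.eventually (lt_mem_nhds h)).exists
  exact ⟨u k, (hus k).2, hk⟩

/-- S_μ is an up-set, and by left continuity the strict inequality defining the complement of the
reflection survives small increases of both coordinates. A single point of the difference therefore
yields a rectangle of positive area inside it. -/
lemma thresholdSet_subset_reflectedSet {μ : ProbabilityMeasure I}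
    (h : volume (thresholdSet μ \ reflectedSet μ) = 0) : thresholdSet μ ⊆ reflectedSet μ := by
  rintro ⟨x, y⟩ hT
  by_contra hR
  rw [mem_thresholdSet] at hT
  rw [mem_reflectedSet, not_le] at hR
  obtain ⟨r, hr, hyr⟩ := exists_lt_cdfLeft y.2.1 hR
  obtain ⟨b, hyb, hbr⟩ := exists_between hyr
  have hb1 : b ≤ 1 := hbr.le.trans (cdfLeft_le_one _ _)
  let b' : I := ⟨b, y.2.1.trans hyb.le, hb1⟩
  have hxr : x < σ r := by
    rw [← unitInterval.symm_symm x]; exact unitInterval.symm_lt_symm.2 hr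
  have hsub : Set.Icc x (σ r) ×ˢ Set.Icc y b' ⊆ thresholdSet μ \ reflectedSet μ := by
    rintro ⟨p, q⟩ ⟨⟨hp1, hp2⟩, ⟨hq1, hq2⟩⟩
    refine ⟨?_, ?_⟩
    · rw [mem_thresholdSet]
      exact (cdfLeft_mono μ (unitInterval.symm_le_symm.2 hq1)).trans (hT.trans hp1)
    · rw [mem_reflectedSet, not_le]
      have h1 : r ≤ σ p := by
        rw [← unitInterval.symm_symm r]; exact unitInterval.symm_le_symm.2 hp2
      exact (show (q : ℝ) ≤ b from hq2).trans_lt (hbr.trans_le (cdfLeft_mono μ h1))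
  have h0 := measure_mono_null hsub h
  rw [Measure.volume_eq_prod, Measure.prod_prod, volume_Icc, volume_Icc, mul_eq_zero,
    ENNReal.ofReal_eq_zero, ENNReal.ofReal_eq_zero] at h0
  rcases h0 with h0 | h0
  · exact absurd h0 (not_le.2 (sub_pos.2 hxr))
  · exact absurd h0 (not_le.2 (sub_pos.2 hyb))

lemma mem_symmetricMeasures_of_volume_eq_zero {μ : ProbabilityMeasure I}
    (h : volume (thresholdSet μ ∆ reflectedSet μ) = 0) : μ ∈ symmetricMeasures := by
  have hTR := thresholdSet_subset_reflectedSet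
    (measure_mono_null (fun p hp => Or.inl hp) h)
  refine Set.Subset.antisymm (fun p hp => ?_) hTR
  have := hTR (show p.swap ∈ thresholdSet μ from hp)
  simpa [reflectedSet] using this

/-! ### The partition of [0,1] into equal cells. -/

/-- The index of the cell containing `x`, for the partition of `[0,1]` into `M + 1` intervals of
equal length. -/
def cell (M : ℕ) (x : I) : Fin (M + 1) :=
  ⟨min ⌊((M : ℝ) + 1) * x⌋₊ M, Nat.lt_succ_of_le (min_le_right _ _)⟩

lemma coe_cell (M : ℕ) (x : I) : (cell M x : ℕ) = min ⌊((M : ℝ) + 1) * x⌋₊ M := rfl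

/-- The point 1 is excluded because there the floor is M + 1 while the cell index is capped at M. -/
lemma natCast_le_iff_le_cell {M : ℕ} {x : I} (hx : x ≠ 1) (m : ℕ) :
    (m : ℝ) ≤ ((M : ℝ) + 1) * x ↔ m ≤ (cell M x : ℕ) := by
  have hx0 : (0 : ℝ) ≤ x := x.2.1
  have hx1 : (x : ℝ) < 1 := unitInterval.coe_lt_one.2 (lt_of_le_of_ne x.2.2 hx)
  have h1 : ⌊((M : ℝ) + 1) * x⌋₊ ≤ M := by
    refine Nat.lt_succ_iff.1 ((Nat.floor_lt (by positivity)).2 ?_)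
    push_cast
    nlinarith
  rw [coe_cell, min_eq_left h1]
  exact (Nat.le_floor_iff (by positivity)).symm

lemma cell_le (M : ℕ) (x : I) : ((cell M x : ℕ) : ℝ) ≤ ((M : ℝ) + 1) * x := by
  have hx0 : (0 : ℝ) ≤ x := x.2.1
  exact (Nat.cast_le.2 (min_le_left _ _)).trans (Nat.floor_le (by positivity))

lemma le_cell_add_one (M : ℕ) (x : I) : ((M : ℝ) + 1) * x ≤ ((cell M x : ℕ) : ℝ) + 1 := by
  have hx1 : (x : ℝ) ≤ 1 := x.2.2
  rw [coe_cell]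
  rcases le_total ⌊((M : ℝ) + 1) * x⌋₊ M with h | h
  · rw [min_eq_left h]; exact (Nat.lt_floor_add_one _).le
  · rw [min_eq_right h]; nlinarith

lemma measurable_cell (M : ℕ) : Measurable (cell M) := by
  have h : Measurable fun x : I => min ⌊((M : ℝ) + 1) * x⌋₊ M :=
    (Nat.measurable_floor.comp (measurable_subtype_coe.const_mul _)).min measurable_const
  refine measurable_to_countable' fun k => ?_
  convert h (measurableSet_singleton (k : ℕ)) using 1
  ext x
  exact Fin.ext_iff

lemma volume_cell_le (M : ℕ) (k : Fin (M + 1)) :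
    volume (cell M ⁻¹' {k}) ≤ ((M : ℝ≥0∞) + 1)⁻¹ := by
  have hM : (0 : ℝ) < (M : ℝ) + 1 := by positivity
  have hk : ((k : ℕ) : ℝ) + 1 ≤ (M : ℝ) + 1 := by exact_mod_cast k.2
  let a : I := ⟨(k : ℕ) / ((M : ℝ) + 1), by positivity, by rw [div_le_one hM]; linarith⟩
  let b : I := ⟨((k : ℕ) + 1) / ((M : ℝ) + 1), by positivity, by rw [div_le_one hM]; linarith⟩
  have hsub : cell M ⁻¹' {k} ⊆ Set.Icc a b := by
    rintro x rfl
    refine ⟨?_, ?_⟩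
    · show (((cell M x : ℕ) : ℝ)) / ((M : ℝ) + 1) ≤ x
      rw [div_le_iff₀' hM]; exact cell_le M x
    · show (x : ℝ) ≤ (((cell M x : ℕ) : ℝ) + 1) / ((M : ℝ) + 1)
      rw [le_div_iff₀' hM]; exact le_cell_add_one M x
  refine (measure_mono hsub).trans ?_
  rw [volume_Icc]
  have : ((b : ℝ) - a) = ((M : ℝ) + 1)⁻¹ := by simp only [a, b]; field_simp; ring
  rw [this, ENNReal.ofReal_inv_of_pos hM]
  refine le_of_eq (congrArg _ ?_)
  rw [ENNReal.ofReal_add (by positivity) zero_le_one]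
  simp

/-- The M + 1 upper bounds 1/(M+1) add up to the total mass 1, so none of them can be strict. -/
lemma volume_cell (M : ℕ) (k : Fin (M + 1)) :
    volume (cell M ⁻¹' {k}) = ((M : ℝ≥0∞) + 1)⁻¹ := by
  have hsum : ∑ j : Fin (M + 1), volume (cell M ⁻¹' {j}) =
      ∑ _j : Fin (M + 1), ((M : ℝ≥0∞) + 1)⁻¹ := by
    rw [sum_measure_preimage_singleton _ fun j _ => measurable_cell M (measurableSet_singleton j)]
    simp only [Finset.coe_univ, Set.preimage_univ, measure_univ, Finset.sum_const,
      Finset.card_univ, Fintype.card_fin, nsmul_eq_mul]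
    push_cast
    exact (ENNReal.mul_inv_cancel (by simp) (by simp)).symm
  refine le_antisymm (volume_cell_le M k) (not_lt.1 fun hlt => ?_)
  refine absurd hsum (ne_of_lt ?_)
  rw [← Finset.add_sum_erase _ _ (Finset.mem_univ k), ← Finset.add_sum_erase _ _ (Finset.mem_univ k)]
  exact ENNReal.add_lt_add_of_lt_of_le
    (ENNReal.sum_ne_top.2 fun j _ => measure_ne_top _ _) hlt
    (Finset.sum_le_sum fun j _ => volume_cell_le M j)

lemma volume_cell_eq_comp (M : ℕ) (g : Fin (M + 1) → Fin (M + 1)) :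
    volume {p : I × I | cell M p.1 = g (cell M p.2)} ≤ ((M : ℝ≥0∞) + 1)⁻¹ := by
  have hm : MeasurableSet {p : I × I | cell M p.1 = g (cell M p.2)} :=
    measurableSet_eq_fun ((measurable_cell M).comp measurable_fst)
      ((Measurable.of_discrete (f := g)).comp ((measurable_cell M).comp measurable_snd))
  rw [Measure.volume_eq_prod, Measure.prod_apply_symm hm]
  calc ∫⁻ y : I, volume ((fun x => (x, y)) ⁻¹' {p : I × I | cell M p.1 = g (cell M p.2)})
      ≤ ∫⁻ _ : I, ((M : ℝ≥0∞) + 1)⁻¹ := lintegral_mono fun y => volume_cell_le M (g (cell M y))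
    _ = _ := by simp

/-! ### Graphs with nested neighbourhoods. -/

section Nested

variable {M : ℕ} {K : SimpleGraph (Fin (M + 1))} [DecidableRel K.Adj]

/-- Every vertex from `l` upwards, except `k` itself, is a neighbour of `k`. With
`degree_le_of_nested`, adjacency of distinct `l`, `k` is left undecided only when `l + K.degree k =
M`. -/
lemma le_degree_of_nested (hK : ∀ a b c, a ≤ b → b ≠ c → K.Adj a c → K.Adj b c)
    {l k : Fin (M + 1)} (h : K.Adj l k) : M ≤ l + K.degree k := by
  have hsub : (Finset.Ici l).erase k ⊆ K.neighborFinset k := by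
    intro j hj
    rw [Finset.mem_erase, Finset.mem_Ici] at hj
    rw [SimpleGraph.mem_neighborFinset]
    exact (hK l j k hj.2 hj.1 h).symm
  have h1 := Finset.card_le_card hsub
  have h2 := Finset.pred_card_le_card_erase (s := Finset.Ici l) (a := k)
  rw [SimpleGraph.card_neighborFinset_eq_degree] at h1
  rw [Fin.card_Ici] at h2
  omega

lemma degree_le_of_nested (hK : ∀ a b c, a ≤ b → b ≠ c → K.Adj a c → K.Adj b c)
    {l k : Fin (M + 1)} (hlk : l ≠ k) (h : ¬ K.Adj l k) : l + K.degree k ≤ M := by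
  have hsub : K.neighborFinset k ⊆ Finset.Ioi l := by
    intro j hj
    rw [SimpleGraph.mem_neighborFinset] at hj
    rw [Finset.mem_Ioi]
    by_contra hle
    exact h (hK j l k (not_lt.1 hle) hlk hj.symm)
  have h1 := Finset.card_le_card hsub
  rw [SimpleGraph.card_neighborFinset_eq_degree, Fin.card_Ioi] at h1
  omega

lemma monotone_degree_of_nested (hK : ∀ a b c, a ≤ b → b ≠ c → K.Adj a c → K.Adj b c) :
    Monotone fun k => K.degree k := by
  intro a b hab
  -- If `a` and `b` are adjacent, neither belongs to its own neighbourhood, so the inclusion holds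
  -- only after removing `b` from one and `a` from the other.
  by_cases hadj : K.Adj a b
  · have hsub : (K.neighborFinset a).erase b ⊆ (K.neighborFinset b).erase a := by
      intro c hc
      rw [Finset.mem_erase, SimpleGraph.mem_neighborFinset] at hc ⊢
      exact ⟨hc.2.ne', hK a b c hab hc.1.symm hc.2⟩
    have h1 := Finset.card_le_card hsub
    rw [Finset.card_erase_of_mem ((K.mem_neighborFinset _ _).2 hadj),
      Finset.card_erase_of_mem ((K.mem_neighborFinset _ _).2 hadj.symm),
      SimpleGraph.card_neighborFinset_eq_degree, SimpleGraph.card_neighborFinset_eq_degree] at h1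
    have h2 : 0 < K.degree b := (K.degree_pos_iff_exists_adj b).2 ⟨a, hadj.symm⟩
    show K.degree a ≤ K.degree b
    omega
  · refine Finset.card_le_card fun c hc => ?_
    rw [SimpleGraph.mem_neighborFinset] at hc ⊢
    refine hK a b c hab (fun hbc => hadj (hbc ▸ hc)) hc

end Nested

/-- A threshold graph can be relabelled so that larger vertices have larger neighbourhoods. -/
lemma IsThreshold.exists_perm_nested {N : ℕ} {H : SimpleGraph (Fin N)} (hH : IsThreshold H) :
    ∃ s : Equiv.Perm (Fin N), ∀ a b c, a ≤ b → b ≠ c →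
      (H.comap s).Adj a c → (H.comap s).Adj b c := by
  obtain ⟨w, t, h⟩ := hH
  refine ⟨Tuple.sort w, fun a b c hab hbc hac => ?_⟩
  have hmono : w (Tuple.sort w a) ≤ w (Tuple.sort w b) := Tuple.monotone_sort w hab
  rw [SimpleGraph.comap_adj] at hac ⊢
  rw [h _ _ hac.ne] at hac
  rw [h _ _ ((Tuple.sort w).injective.ne hbc)]
  linarith

/-! ### The degree distribution determines adjacency up to small area. -/

open Classical in
lemma cdfLeft_degreeDist {M : ℕ} (H : SimpleGraph (Fin (M + 1))) (x : I) :
    cdfLeft (degreeDist H) x =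
      ((Finset.univ.filter fun v => (H.degree v : ℝ) < ((M : ℝ) + 1) * x).card : ℝ) / ((M : ℝ) + 1) := by
  have hM : (0 : ℝ) < (M : ℝ) + 1 := by positivity
  have h1 : (degreeDist H : Measure I) (Set.Iio x) =
      (PMF.uniformOfFintype (Fin (M + 1))).toMeasure (normalizedDegree H ⁻¹' Set.Iio x) :=
    PMF.toMeasure_map_apply _ _ _ (Measurable.of_discrete) measurableSet_Iio
  rw [cdfLeft, Measure.real, h1, PMF.toMeasure_uniformOfFintype_apply _ .of_discrete,
    ENNReal.toReal_div]
  have h2 : Fintype.card (normalizedDegree H ⁻¹' Set.Iio x) =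
      (Finset.univ.filter fun v => (H.degree v : ℝ) < ((M : ℝ) + 1) * x).card := by
    rw [← Set.toFinset_card]
    congr 1
    ext v
    simp only [Set.mem_toFinset, Set.mem_preimage, Set.mem_Iio, Finset.mem_filter,
      Finset.mem_univ, true_and]
    rw [← div_lt_iff₀' hM, ← Subtype.coe_lt_coe]
    simp [normalizedDegree]
  rw [h2]
  simp [ENNReal.toReal_add]

/-- The set of pairs of points whose cells are adjacent vertices, after the relabelling `s`. -/
def cellSet {M : ℕ} (H : SimpleGraph (Fin (M + 1))) (s : Equiv.Perm (Fin (M + 1))) : Set (I × I) :=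
  {p | H.Adj (s (cell M p.1)) (s (cell M p.2))}

lemma measurableSet_cellSet {M : ℕ} (H : SimpleGraph (Fin (M + 1)))
    (s : Equiv.Perm (Fin (M + 1))) : MeasurableSet (cellSet H s) := by
  have h : Measurable fun p : I × I => (cell M p.1, cell M p.2) :=
    ((measurable_cell M).comp measurable_fst).prodMk ((measurable_cell M).comp measurable_snd)
  exact h (MeasurableSet.of_discrete (s := {q | H.Adj (s q.1) (s q.2)}))

open Classical in
-- Degrees increase along the ordering, so the vertices of degree below (M+1)(1-x) form an initial
-- segment. Membership says that this segment has at most `cell M y` elements, that is, that vertex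
-- `cell M y` lies outside it.
lemma mem_reflectedSet_degreeDist_iff {M : ℕ} {H : SimpleGraph (Fin (M + 1))}
    {s : Equiv.Perm (Fin (M + 1))}
    (hs : ∀ a b c, a ≤ b → b ≠ c → (H.comap s).Adj a c → (H.comap s).Adj b c)
    {x y : I} (hx : x ≠ 1) (hy : y ≠ 1) :
    (x, y) ∈ reflectedSet (degreeDist H) ↔
      M + 1 ≤ (cell M x : ℕ) + (H.comap s).degree (cell M y) := by
  have hM : (0 : ℝ) < (M : ℝ) + 1 := by positivity
  have hdeg : ∀ k, (H.comap s).degree k = H.degree (s k) := fun k =>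
    ((SimpleGraph.Iso.comap s H).degree_eq k).symm
  have hmono := monotone_degree_of_nested hs
  set D : Fin (M + 1) → ℕ := fun k => (H.comap s).degree k with hD
  have hcard : (Finset.univ.filter fun v => (H.degree v : ℝ) < ((M : ℝ) + 1) * (σ x : I)).card =
      (Finset.univ.filter fun k => (D k : ℝ) < ((M : ℝ) + 1) * (σ x : I)).card := by
    refine (Finset.card_bij (fun k _ => s k) ?_ (fun a _ b _ h => s.injective h) ?_).symm
    · intro k hk
      exact Finset.mem_filter.2 ⟨Finset.mem_univ _, hdeg k ▸ (Finset.mem_filter.1 hk).2⟩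
    · intro v hv
      obtain ⟨k, rfl⟩ := s.surjective v
      exact ⟨k, Finset.mem_filter.2 ⟨Finset.mem_univ _, by
        rw [hD]; simp only [hdeg]; exact (Finset.mem_filter.1 hv).2⟩, rfl⟩
  rw [mem_reflectedSet, cdfLeft_degreeDist, div_le_iff₀' hM, natCast_le_iff_le_cell hy, hcard]
  have key : (D (cell M y) : ℝ) < ((M : ℝ) + 1) * (σ x : I) ↔
      ¬ M + 1 ≤ (cell M x : ℕ) + D (cell M y) := by
    have h1 : D (cell M y) ≤ M + 1 := by
      have := (H.comap s).degree_lt_card_verts (cell M y)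
      rw [Fintype.card_fin] at this
      exact this.le
    have h2 := natCast_le_iff_le_cell (M := M) hx (M + 1 - D (cell M y))
    rw [Nat.cast_sub h1] at h2
    rw [← not_le, not_iff_not, unitInterval.coe_symm_eq]
    push_cast at h2
    constructor
    · intro h
      have := h2.1 (by linarith)
      omega
    · intro h
      have := h2.2 (by omega)
      linarith
  constructor
  · intro h
    by_contra hcon
    have hlt := key.2 hcon
    have hsub : Finset.Iic (cell M y) ⊆
        Finset.univ.filter fun k => (D k : ℝ) < ((M : ℝ) + 1) * (σ x : I) := by
      intro k hk
      rw [Finset.mem_filter]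
      exact ⟨Finset.mem_univ _, (Nat.cast_le.2 (hmono (Finset.mem_Iic.1 hk))).trans_lt hlt⟩
    have := Finset.card_le_card hsub
    rw [Fin.card_Iic] at this
    omega
  · intro h
    have hsub : (Finset.univ.filter fun k => (D k : ℝ) < ((M : ℝ) + 1) * (σ x : I)) ⊆
        Finset.Iio (cell M y) := by
      intro k hk
      rw [Finset.mem_filter] at hk
      rw [Finset.mem_Iio]
      by_contra hle
      exact key.1 ((Nat.cast_le.2 (hmono (not_lt.1 hle))).trans_lt hk.2) h
    have := Finset.card_le_card hsub
    rwa [Fin.card_Iio] at this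

lemma volume_symmDiff_cellSet_le {M : ℕ} {H : SimpleGraph (Fin (M + 1))}
    {s : Equiv.Perm (Fin (M + 1))}
    (hs : ∀ a b c, a ≤ b → b ≠ c → (H.comap s).Adj a c → (H.comap s).Adj b c) :
    volume (cellSet H s ∆ reflectedSet (degreeDist H)) ≤ 2 * ((M : ℝ≥0∞) + 1)⁻¹ := by
  classical
  -- The index `g k` is the one undecided by the degree of `k`. The exceptional pairs are these, the
  -- diagonal cells (no loops), and the null lines where a coordinate is 1.
  let g : Fin (M + 1) → Fin (M + 1) := fun k => ⟨M - (H.comap s).degree k, by omega⟩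
  have hsub : cellSet H s ∆ reflectedSet (degreeDist H) ⊆
      ({p : I × I | cell M p.1 = id (cell M p.2)} ∪ {p : I × I | cell M p.1 = g (cell M p.2)}) ∪
        ({1} ×ˢ Set.univ ∪ Set.univ ×ˢ {1}) := by
    rintro ⟨x, y⟩ hp
    by_contra hcon
    simp only [Set.mem_union, Set.mem_ofPred_eq, Set.mem_prod, Set.mem_singleton_iff,
      Set.mem_univ, and_true, true_and, not_or, id] at hcon
    obtain ⟨⟨h1, h2⟩, hx, hy⟩ := hcon
    have hne : (cell M x : ℕ) ≠ M - (H.comap s).degree (cell M y) := fun h => h2 (Fin.ext h)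
    have hiff : (x, y) ∈ cellSet H s ↔ (x, y) ∈ reflectedSet (degreeDist H) := by
      rw [mem_reflectedSet_degreeDist_iff hs hx hy]
      constructor
      · intro h
        have := le_degree_of_nested hs (l := cell M x) (k := cell M y) h
        omega
      · intro h
        by_contra hnot
        have := degree_le_of_nested hs (l := cell M x) (k := cell M y) h1 hnot
        omega
    rcases hp with ⟨ha, hb⟩ | ⟨ha, hb⟩
    · exact hb (hiff.1 ha)
    · exact hb (hiff.2 ha)
  refine (measure_mono hsub).trans ((measure_union_le _ _).trans ?_)
  have h0 : volume (({1} ×ˢ Set.univ ∪ Set.univ ×ˢ {1} : Set (I × I))) = 0 := by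
    rw [Measure.volume_eq_prod]
    exact measure_union_null (by simp [Measure.prod_prod]) (by simp [Measure.prod_prod])
  rw [h0, add_zero, two_mul]
  exact (measure_union_le _ _).trans
    (add_le_add (volume_cell_eq_comp M id) (volume_cell_eq_comp M g))

/-! ### Sampling graphs from uniform points. -/

instance {V : Type*} [Countable V] : MeasurableSingletonClass (SimpleGraph V) where
  measurableSet_singleton K := by
    refine ⟨{K.Adj}, measurableSet_singleton _, ?_⟩
    ext H
    exact SimpleGraph.adj_inj

instance (n : ℕ) : IsProbabilityMeasure (uniformPoints n) := by
  unfold uniformPoints; infer_instance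

lemma measurable_pointGraph {n : ℕ} {S : Set (I × I)} (hS : MeasurableSet S) :
    Measurable (pointGraph S : (Fin n → I) → SimpleGraph (Fin n)) := by
  rw [SimpleGraph.measurable_iff_adj]
  intro i j
  simp only [pointGraph, SimpleGraph.fromRel_adj]
  have h : ∀ i j : Fin n, Measurable fun u : Fin n → I => (u i, u j) ∈ S := fun i j =>
    measurableSet_setOfPred.1 (((measurable_pi_apply i).prodMk (measurable_pi_apply j)) hS)
  exact measurable_const.and ((h i j).or (h j i))

lemma uniformPoints_pair {n : ℕ} {i j : Fin n} (hij : i ≠ j) {S : Set (I × I)}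
    (hS : MeasurableSet S) : uniformPoints n {u | (u i, u j) ∈ S} = volume S := by
  have hind : iIndepFun (fun (i : Fin n) (u : Fin n → I) => u i) (uniformPoints n) :=
    iIndepFun_pi (X := fun _ => id) (fun _ => aemeasurable_id)
  have hmap : ∀ i : Fin n, (uniformPoints n).map (fun u => u i) = volume := fun i =>
    (measurePreserving_eval (fun _ : Fin n => (volume : Measure I)) i).map_eq
  have h := (indepFun_iff_map_prod_eq_prod_map_map (measurable_pi_apply i).aemeasurable
    (measurable_pi_apply j).aemeasurable).1 (hind.indepFun hij)
  rw [hmap, hmap, ← Measure.volume_eq_prod] at h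
  rw [← h, Measure.map_apply ((measurable_pi_apply i).prodMk (measurable_pi_apply j)) hS]
  rfl

lemma uniformPoints_real_exists_pair_le {n : ℕ} {S : Set (I × I)} (hS : MeasurableSet S) :
    (uniformPoints n).real {u | ∃ i j, i ≠ j ∧ (u i, u j) ∈ S} ≤ (n : ℝ) ^ 2 * volume.real S := by
  classical
  have hsub : {u : Fin n → I | ∃ i j, i ≠ j ∧ (u i, u j) ∈ S} ⊆
      ⋃ p ∈ (Finset.univ.filter fun p : Fin n × Fin n => p.1 ≠ p.2),
        {u : Fin n → I | (u p.1, u p.2) ∈ S} := by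
    rintro u ⟨i, j, hij, h⟩
    exact Set.mem_biUnion (x := (i, j)) (by simpa using hij) h
  refine (measureReal_mono hsub (measure_ne_top _ _)).trans
    ((measureReal_biUnion_finset_le _ _).trans ?_)
  have hterm : ∀ p ∈ (Finset.univ.filter fun p : Fin n × Fin n => p.1 ≠ p.2),
      (uniformPoints n).real {u : Fin n → I | (u p.1, u p.2) ∈ S} = volume.real S := fun p hp => by
    rw [Measure.real, uniformPoints_pair (Finset.mem_filter.1 hp).2 hS, Measure.real]
  rw [Finset.sum_congr rfl hterm, Finset.sum_const, nsmul_eq_mul]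
  refine mul_le_mul_of_nonneg_right ?_ measureReal_nonneg
  have := (Finset.filter_subset (fun p : Fin n × Fin n => p.1 ≠ p.2) Finset.univ)
  have := Finset.card_le_card this
  rw [Finset.card_univ, Fintype.card_prod, Fintype.card_fin] at this
  rw [sq]
  exact_mod_cast this

open Classical in
/-- Sampling cells of independent uniform points gives a uniformly random map. -/
lemma uniformPoints_real_cell {n M : ℕ} (s : Equiv.Perm (Fin (M + 1)))
    (p : (Fin n → Fin (M + 1)) → Prop) :
    (uniformPoints n).real {u | p fun i => s (cell M (u i))} =
      ((Finset.univ.filter p).card : ℝ) / ((M : ℝ) + 1) ^ n := by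
  have hs : Measurable (fun x => s (cell M x)) :=
    (Measurable.of_discrete (f := s)).comp (measurable_cell M)
  have hmeas : Measurable fun (u : Fin n → I) (i : Fin n) => s (cell M (u i)) :=
    measurable_pi_lambda _ fun i => hs.comp (measurable_pi_apply i)
  have hmap : (uniformPoints n).map (fun u i => s (cell M (u i))) =
      Measure.pi fun _ => volume.map (fun x => s (cell M x)) := by
    have : IsProbabilityMeasure ((volume : Measure I).map (fun x => s (cell M x))) :=
      Measure.isProbabilityMeasure_map hs.aemeasurable
    exact Measure.pi_map_pi fun _ => hs.aemeasurable
  have : IsProbabilityMeasure ((volume : Measure I).map (fun x => s (cell M x))) :=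
    Measure.isProbabilityMeasure_map hs.aemeasurable
  have hk : ∀ k, (volume : Measure I).map (fun x => s (cell M x)) {k} = ((M : ℝ≥0∞) + 1)⁻¹ := by
    intro k
    rw [Measure.map_apply hs (measurableSet_singleton k), ← volume_cell M (s.symm k)]
    congr 1
    ext x
    simp [Equiv.eq_symm_apply]
  have hsingle : ∀ φ : Fin n → Fin (M + 1),
      (uniformPoints n).map (fun u i => s (cell M (u i))) {φ} = (((M : ℝ≥0∞) + 1)⁻¹) ^ n := by
    intro φ
    rw [hmap, Measure.pi_singleton]
    simp [hk]
  have hset : {u : Fin n → I | p fun i => s (cell M (u i))} =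
      (fun (u : Fin n → I) i => s (cell M (u i))) ⁻¹' (Finset.univ.filter p : Finset _) := by
    ext u; simp
  rw [hset, Measure.real, ← Measure.map_apply hmeas (Finset.measurableSet _),
    ← sum_measure_singleton, Finset.sum_congr rfl fun φ _ => hsingle φ, Finset.sum_const,
    nsmul_eq_mul, ENNReal.toReal_mul, ENNReal.toReal_pow, ENNReal.toReal_inv,
    ENNReal.toReal_add (by simp) (by simp)]
  simp [div_eq_mul_inv]

open Classical in
/-- The proportion of maps `[n] → V(H)` that pull back the graph `H` to `K`. -/
def inducedDensity {n M : ℕ} (K : SimpleGraph (Fin n)) (H : SimpleGraph (Fin (M + 1))) : ℝ :=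
  ((Finset.univ.filter fun φ : Fin n → Fin (M + 1) => H.comap φ = K).card : ℝ) /
    ((M : ℝ) + 1) ^ n

lemma inducedDensity_eq {n M : ℕ} (s : Equiv.Perm (Fin (M + 1))) (K : SimpleGraph (Fin n))
    (H : SimpleGraph (Fin (M + 1))) : inducedDensity K H =
      (uniformPoints n).real {u | H.comap (fun i => s (cell M (u i))) = K} :=
  (uniformPoints_real_cell s fun φ => H.comap φ = K).symm

/-- Both graphs are built from the same points, and they coincide unless some pair of points falls
in the symmetric difference; a union bound over pairs gives n². -/
lemma abs_inducedDensity_sub_le {n M : ℕ} (s : Equiv.Perm (Fin (M + 1))) (K : SimpleGraph (Fin n))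
    (H : SimpleGraph (Fin (M + 1))) {S : Set (I × I)} (hS : MeasurableSet S) :
    |inducedDensity K H - (uniformPoints n).real {u | pointGraph S u = K}| ≤
      (n : ℝ) ^ 2 * volume.real (cellSet H s ∆ S) := by
  have hcell : Measurable fun (u : Fin n → I) (i : Fin n) => s (cell M (u i)) :=
    measurable_pi_lambda _ fun i =>
      (Measurable.of_discrete (f := s)).comp ((measurable_cell M).comp (measurable_pi_apply i))
  have h1 : MeasurableSet {u : Fin n → I | H.comap (fun i => s (cell M (u i))) = K} :=
    hcell (MeasurableSet.of_discrete (s := {φ | H.comap φ = K}))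
  have h2 : MeasurableSet {u : Fin n → I | pointGraph S u = K} :=
    measurable_pointGraph hS (measurableSet_singleton K)
  rw [inducedDensity_eq s]
  refine (abs_measureReal_sub_le_measureReal_symmDiff h1.nullMeasurableSet
    h2.nullMeasurableSet).trans ((measureReal_mono ?_ (measure_ne_top _ _)).trans
    (uniformPoints_real_exists_pair_le ((measurableSet_cellSet H s).symmDiff hS)))
  intro u hu
  by_contra hcon
  have hiff : ∀ i j, i ≠ j → (H.Adj (s (cell M (u i))) (s (cell M (u j))) ↔ (u i, u j) ∈ S) := by
    intro i j hij
    by_contra hne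
    refine hcon ⟨i, j, hij, ?_⟩
    rw [Set.mem_symmDiff]
    change (H.Adj _ _ ∧ _) ∨ (_ ∧ ¬ H.Adj _ _)
    tauto
  have heq : H.comap (fun i => s (cell M (u i))) = pointGraph S u := by
    ext i j
    rw [pointGraph, SimpleGraph.fromRel_adj, SimpleGraph.comap_adj]
    constructor
    · intro h
      have hij : i ≠ j := by rintro rfl; exact h.ne rfl
      exact ⟨hij, Or.inl ((hiff i j hij).1 h)⟩
    · rintro ⟨hij, h | h⟩
      · exact (hiff i j hij).2 h
      · exact ((hiff j i hij.symm).2 h).symm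
  rw [Set.mem_symmDiff, Set.mem_ofPred_eq, Set.mem_ofPred_eq, heq] at hu
  tauto

lemma abs_inducedDensity_sub_le_one {n M : ℕ} (K : SimpleGraph (Fin n))
    (H : SimpleGraph (Fin (M + 1))) (S : Set (I × I)) :
    |inducedDensity K H - (uniformPoints n).real {u | pointGraph S u = K}| ≤ 1 := by
  rw [inducedDensity_eq (Equiv.refl _)]
  exact abs_sub_le_of_nonneg_of_le measureReal_nonneg measureReal_le_one measureReal_nonneg
    measureReal_le_one

open Classical in
lemma card_not_injective_div_le (n M : ℕ) :
    ((Finset.univ.filter fun φ : Fin n → Fin (M + 1) => ¬ Function.Injective φ).card : ℝ) /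
      ((M : ℝ) + 1) ^ n ≤ (n : ℝ) ^ 2 * ((M : ℝ) + 1)⁻¹ := by
  have hm : MeasurableSet {p : I × I | cell M p.1 = id (cell M p.2)} :=
    measurableSet_eq_fun ((measurable_cell M).comp measurable_fst)
      ((measurable_cell M).comp measurable_snd)
  suffices h : (uniformPoints n).real
      {u | ¬ Function.Injective fun i => Equiv.refl (Fin (M + 1)) (cell M (u i))} ≤
        (n : ℝ) ^ 2 * ((M : ℝ) + 1)⁻¹ by
    rw [uniformPoints_real_cell (Equiv.refl _) fun φ => ¬ Function.Injective φ] at h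
    convert h
  refine ((measureReal_mono ?_ (measure_ne_top _ _)).trans
    (uniformPoints_real_exists_pair_le hm)).trans
    (mul_le_mul_of_nonneg_left ?_ (by positivity))
  · intro u hu
    rw [Set.mem_ofPred_eq, Function.not_injective_iff] at hu
    obtain ⟨i, j, h, hij⟩ := hu
    exact ⟨i, j, hij, h⟩
  · have := ENNReal.toReal_mono (by simp) (volume_cell_eq_comp M id)
    rwa [ENNReal.toReal_inv, ENNReal.toReal_add (by simp) (by simp), ENNReal.toReal_natCast,
      ENNReal.toReal_one] at this

/-- Adjacency is symmetric, so swapping coordinates fixes the cell set and exchanges S_μ with its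
reflection. -/
lemma volume_cellSet_symmDiff_thresholdSet {M : ℕ} (H : SimpleGraph (Fin (M + 1)))
    (s : Equiv.Perm (Fin (M + 1))) (μ : ProbabilityMeasure I) :
    volume (cellSet H s ∆ thresholdSet μ) = volume (cellSet H s ∆ reflectedSet μ) := by
  rw [← volume_swap_preimage
    ((measurableSet_cellSet H s).symmDiff (measurableSet_thresholdSet μ))]
  congr 1
  have hsymm : Prod.swap ⁻¹' cellSet H s = cellSet H s := by
    ext p; exact H.adj_comm _ _
  rw [Set.symmDiff_def, Set.preimage_union, Set.preimage_sdiff, Set.preimage_sdiff, hsymm]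
  rfl

lemma volume_cellSet_symmDiff_reflectedSet_le {M : ℕ} {H : SimpleGraph (Fin (M + 1))}
    {s : Equiv.Perm (Fin (M + 1))}
    (hs : ∀ a b c, a ≤ b → b ≠ c → (H.comap s).Adj a c → (H.comap s).Adj b c)
    (μ : ProbabilityMeasure I) :
    volume (cellSet H s ∆ reflectedSet μ) ≤
      2 * ((M : ℝ≥0∞) + 1)⁻¹ + volume (reflectedSet (degreeDist H) ∆ reflectedSet μ) :=
  (measure_symmDiff_le _ _ _).trans (add_le_add_left (volume_symmDiff_cellSet_le hs) _)

lemma IsThreshold.abs_inducedDensity_sub_le {n M : ℕ} {H : SimpleGraph (Fin (M + 1))}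
    (hH : IsThreshold H) (K : SimpleGraph (Fin n)) {μ : ProbabilityMeasure I} {ε : ℝ}
    (hε : volume.real (reflectedSet (degreeDist H) ∆ reflectedSet μ) ≤ ε) :
    |inducedDensity K H - (uniformPoints n).real {u | pointGraph (thresholdSet μ) u = K}| ≤
      (n : ℝ) ^ 2 * (2 * ((M : ℝ) + 1)⁻¹ + ε) := by
  obtain ⟨s, hs⟩ := hH.exists_perm_nested
  refine (ThresholdLimit.abs_inducedDensity_sub_le s K H (measurableSet_thresholdSet μ)).trans
    (mul_le_mul_of_nonneg_left ?_ (by positivity))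
  rw [Measure.real, volume_cellSet_symmDiff_thresholdSet]
  have h := ENNReal.toReal_mono (by finiteness) (volume_cellSet_symmDiff_reflectedSet_le hs μ)
  rw [ENNReal.toReal_add (by finiteness) (by finiteness), ENNReal.toReal_mul, ENNReal.toReal_inv,
    ENNReal.toReal_add (by simp) (by simp), ENNReal.toReal_natCast, ENNReal.toReal_one] at h
  refine h.trans (add_le_add (le_of_eq (by simp)) hε)

lemma IsThreshold.volume_symmDiff_le {M : ℕ} {H : SimpleGraph (Fin (M + 1))}
    (hH : IsThreshold H) (μ : ProbabilityMeasure I) :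
    volume (thresholdSet μ ∆ reflectedSet μ) ≤
      2 * (2 * ((M : ℝ≥0∞) + 1)⁻¹ + volume (reflectedSet (degreeDist H) ∆ reflectedSet μ)) := by
  obtain ⟨s, hs⟩ := hH.exists_perm_nested
  have h := volume_cellSet_symmDiff_reflectedSet_le hs μ
  refine (measure_symmDiff_le (thresholdSet μ) (cellSet H s) (reflectedSet μ)).trans ?_
  rw [symmDiff_comm, volume_cellSet_symmDiff_thresholdSet, two_mul]
  exact add_le_add h h

/-! ### Exchangeable consistent sequences. -/

section Sampling

variable {Ω : ℕ → Type*} [∀ n, MeasurableSpace (Ω n)] {P : ∀ n, Measure (Ω n)}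
  {G : ∀ n, Ω n → SimpleGraph (Fin n)}

lemma identDistrib_comap_castLE
    (hcons : ∀ n, 1 ≤ n →
      IdentDistrib (fun ω => (G (n + 1) ω).comap Fin.castSucc) (G n) (P (n + 1)) (P n))
    (hmeas : ∀ n, 1 ≤ n → AEMeasurable (G n) (P n))
    {n : ℕ} (hn : 1 ≤ n) {N : ℕ} (h : n ≤ N) :
    IdentDistrib (fun ω => (G N ω).comap (Fin.castLE h)) (G n) (P N) (P n) := by
  induction N, h using Nat.le_induction with
  | base => exact IdentDistrib.refl (hmeas n hn)
  | succ N h ih =>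
    exact ((hcons N (hn.trans h)).comp (u := fun H : SimpleGraph (Fin N) => H.comap (Fin.castLE h))
      .of_discrete).trans ih

/-- In an exchangeable and consistent sequence, the graph induced by any `n` distinct vertices is
distributed as `G n`. -/
lemma identDistrib_comap_of_injective
    (hmeas : ∀ n, 1 ≤ n → AEMeasurable (G n) (P n))
    (hexch : ∀ n, 1 ≤ n → ∀ π : Equiv.Perm (Fin n),
      IdentDistrib (fun ω => (G n ω).map π.toEmbedding) (G n) (P n) (P n))
    (hcons : ∀ n, 1 ≤ n →
      IdentDistrib (fun ω => (G (n + 1) ω).comap Fin.castSucc) (G n) (P (n + 1)) (P n))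
    {n N : ℕ} (hn : 1 ≤ n) {φ : Fin n → Fin N} (hφ : Function.Injective φ) :
    IdentDistrib (fun ω => (G N ω).comap φ) (G n) (P N) (P n) := by
  classical
  have hnN : n ≤ N := by simpa using Fintype.card_le_of_injective φ hφ
  -- This matching of the two ranges extends to a permutation carrying the initial segment to `φ`,
  -- reducing the claim to exchangeability and restriction.
  let e : {x // x ∈ Set.range (Fin.castLE hnN)} ≃ {x // x ∈ Set.range φ} :=
    (Equiv.ofInjective _ (Fin.castLE_injective hnN)).symm.trans (Equiv.ofInjective φ hφ)
  have he : ∀ i, e.extendSubtype (Fin.castLE hnN i) = φ i := fun i => by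
    rw [e.extendSubtype_apply_of_mem _ ⟨i, rfl⟩]
    have : (⟨Fin.castLE hnN i, ⟨i, rfl⟩⟩ : {x // x ∈ Set.range (Fin.castLE hnN)}) =
      Equiv.ofInjective _ (Fin.castLE_injective hnN) i := rfl
    rw [this]
    simp [e]
  have hfun : ∀ ω, ((G N ω).map e.extendSubtype.symm.toEmbedding).comap (Fin.castLE hnN) =
      (G N ω).comap φ := fun ω => by
    ext i j
    rw [SimpleGraph.comap_adj, SimpleGraph.comap_adj, ← he i, ← he j]
    have := SimpleGraph.map_adj_apply (G := G N ω) (f := e.extendSubtype.symm.toEmbedding)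
      (a := e.extendSubtype (Fin.castLE hnN i)) (b := e.extendSubtype (Fin.castLE hnN j))
    simpa using this
  have h1 := (hexch N (hn.trans hnN) e.extendSubtype.symm).comp
    (u := fun H : SimpleGraph (Fin N) => H.comap (Fin.castLE hnN)) .of_discrete
  have h2 : (fun H : SimpleGraph (Fin N) => H.comap (Fin.castLE hnN)) ∘
      (fun ω => (G N ω).map e.extendSubtype.symm.toEmbedding) = fun ω => (G N ω).comap φ :=
    funext hfun
  rw [h2] at h1
  exact h1.trans (identDistrib_comap_castLE hcons hmeas hn hnN)

lemma identDistrib_measureReal_eq {α β γ : Type*} [MeasurableSpace α] [MeasurableSpace β]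
    [MeasurableSpace γ] [MeasurableSingletonClass γ] {X : α → γ} {Y : β → γ} {μ : Measure α}
    {ν : Measure β} (h : IdentDistrib X Y μ ν) (c : γ) :
    μ.real {a | X a = c} = ν.real {b | Y b = c} :=
  congrArg ENNReal.toReal (h.measure_mem_eq (measurableSet_singleton c))

/-- Averaging over all maps [n] → [M+1], each injective map contributes exactly P(G_n = K). Each
other map errs by at most 1, and the proportion of such maps is at most n²/(M+1). -/
lemma abs_integral_inducedDensity_sub_le [∀ n, IsProbabilityMeasure (P n)]
    (hmeas : ∀ n, 1 ≤ n → AEMeasurable (G n) (P n))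
    (hexch : ∀ n, 1 ≤ n → ∀ π : Equiv.Perm (Fin n),
      IdentDistrib (fun ω => (G n ω).map π.toEmbedding) (G n) (P n) (P n))
    (hcons : ∀ n, 1 ≤ n →
      IdentDistrib (fun ω => (G (n + 1) ω).comap Fin.castSucc) (G n) (P (n + 1)) (P n))
    {n : ℕ} (hn : 1 ≤ n) (K : SimpleGraph (Fin n)) (M : ℕ) :
    |(P n).real {ω | G n ω = K} - ∫ ω, inducedDensity K (G (M + 1) ω) ∂P (M + 1)| ≤
      (n : ℝ) ^ 2 * ((M : ℝ) + 1)⁻¹ := by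
  classical
  set p := (P n).real {ω | G n ω = K} with hp
  have hM : (0 : ℝ) < ((M : ℝ) + 1) ^ n := by positivity
  have hms : ∀ φ : Fin n → Fin (M + 1),
      NullMeasurableSet {ω | (G (M + 1) ω).comap φ = K} (P (M + 1)) := fun φ =>
    (hmeas (M + 1) (by omega)).nullMeasurable
      (MeasurableSet.of_discrete (s := {H : SimpleGraph (Fin (M + 1)) | H.comap φ = K}))
  have hint : ∫ ω, inducedDensity K (G (M + 1) ω) ∂P (M + 1) =
      (∑ φ : Fin n → Fin (M + 1), (P (M + 1)).real {ω | (G (M + 1) ω).comap φ = K}) /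
        ((M : ℝ) + 1) ^ n := by
    have h1 : ∀ ω, inducedDensity K (G (M + 1) ω) = (∑ φ : Fin n → Fin (M + 1),
        Set.indicator {ω | (G (M + 1) ω).comap φ = K} (fun _ => (1 : ℝ)) ω) /
          ((M : ℝ) + 1) ^ n := by
      intro ω
      rw [inducedDensity, Finset.card_filter]
      push_cast
      rfl
    simp_rw [h1]
    rw [integral_div, integral_finsetSum]
    · congr 1
      refine Finset.sum_congr rfl fun φ _ => ?_
      rw [integral_indicator₀ (hms φ)]
      simp
    · exact fun φ _ => (integrable_const 1).indicator₀ (hms φ)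
  have hconst : p = (∑ _φ : Fin n → Fin (M + 1), p) / ((M : ℝ) + 1) ^ n := by
    rw [Finset.sum_const, Finset.card_univ, Fintype.card_fun, Fintype.card_fin, Fintype.card_fin,
      nsmul_eq_mul]
    push_cast
    field_simp
  rw [hint, hconst, ← sub_div, ← Finset.sum_sub_distrib, abs_div, abs_of_pos hM]
  refine le_trans ?_ (card_not_injective_div_le n M)
  refine div_le_div_of_nonneg_right ?_ hM.le
  refine (Finset.abs_sum_le_sum_abs _ _).trans ?_
  rw [Finset.card_filter]
  push_cast
  refine Finset.sum_le_sum fun φ _ => ?_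
  by_cases hφ : Function.Injective φ
  · rw [identDistrib_measureReal_eq (identDistrib_comap_of_injective hmeas hexch hcons hn hφ) K]
    simp [hφ, hp]
  · simp only [hφ, not_false_eq_true, if_true]
    exact abs_sub_le_of_nonneg_of_le measureReal_nonneg measureReal_le_one measureReal_nonneg
      measureReal_le_one

lemma integrable_comp_graph {n : ℕ} [IsFiniteMeasure (P n)] (h : AEMeasurable (G n) (P n))
    (f : SimpleGraph (Fin n) → ℝ) : Integrable (fun ω => f (G n ω)) (P n) := by
  obtain ⟨C, hC⟩ := (Set.finite_range fun H => ‖f H‖).bddAbove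
  exact Integrable.of_bound
    ((Measurable.of_discrete (f := f)).comp_aemeasurable h).aestronglyMeasurable C
    (.of_forall fun ω => hC ⟨G n ω, rfl⟩)

/-- The deterministic estimate applies when the reflected sets are within `ε`; on the complementary
event the error is at most 1. -/
lemma abs_integral_sub_le [∀ n, IsProbabilityMeasure (P n)]
    (hmeas : ∀ n, 1 ≤ n → AEMeasurable (G n) (P n))
    (hthr : ∀ n, 1 ≤ n → ∀ᵐ ω ∂(P n), IsThreshold (G n ω))
    {n : ℕ} (K : SimpleGraph (Fin n)) (M : ℕ) (μ : ProbabilityMeasure I) {ε : ℝ} (hε : 0 ≤ ε) :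
    |∫ ω, inducedDensity K (G (M + 1) ω) ∂P (M + 1) -
        (uniformPoints n).real {u | pointGraph (thresholdSet μ) u = K}| ≤
      (n : ℝ) ^ 2 * (2 * ((M : ℝ) + 1)⁻¹ + ε) +
        (P (M + 1)).real {ω | volume.real
          (reflectedSet (degreeDist (G (M + 1) ω)) ∆ reflectedSet μ) ≤ ε}ᶜ := by
  set c := (uniformPoints n).real {u | pointGraph (thresholdSet μ) u = K}
  have hm := hmeas (M + 1) (by omega)
  have hset : NullMeasurableSet {ω | volume.real
      (reflectedSet (degreeDist (G (M + 1) ω)) ∆ reflectedSet μ) ≤ ε}ᶜ (P (M + 1)) :=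
    (hm.nullMeasurable (MeasurableSet.of_discrete (s := {H : SimpleGraph (Fin (M + 1)) |
      volume.real (reflectedSet (degreeDist H) ∆ reflectedSet μ) ≤ ε}))).compl
  have hc : c = ∫ _, c ∂P (M + 1) := by simp
  rw [hc, ← integral_sub (integrable_comp_graph hm _) (integrable_const c)]
  refine abs_integral_le_integral_abs.trans ?_
  have hR : ∫ ω, ((n : ℝ) ^ 2 * (2 * ((M : ℝ) + 1)⁻¹ + ε) +
      Set.indicator {ω | volume.real
        (reflectedSet (degreeDist (G (M + 1) ω)) ∆ reflectedSet μ) ≤ ε}ᶜ (fun _ => (1 : ℝ)) ω)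
      ∂P (M + 1) = (n : ℝ) ^ 2 * (2 * ((M : ℝ) + 1)⁻¹ + ε) +
        (P (M + 1)).real {ω | volume.real
          (reflectedSet (degreeDist (G (M + 1) ω)) ∆ reflectedSet μ) ≤ ε}ᶜ := by
    rw [integral_add (integrable_const _) ((integrable_const 1).indicator₀ hset),
      integral_indicator₀ hset]
    simp
  rw [← hR]
  refine integral_mono_ae (integrable_comp_graph hm fun H => |inducedDensity K H - c|)
    ((integrable_const _).add ((integrable_const 1).indicator₀ hset)) ?_
  filter_upwards [hthr (M + 1) (by omega)] with ω hω
  by_cases h : volume.real (reflectedSet (degreeDist (G (M + 1) ω)) ∆ reflectedSet μ) ≤ ε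
  · rw [Set.indicator_of_notMem (by simpa using h), add_zero]
    exact hω.abs_inducedDensity_sub_le K h
  · rw [Set.indicator_of_mem (by simpa using h)]
    have := abs_inducedDensity_sub_le_one K (G (M + 1) ω) (thresholdSet μ)
    have h0 : 0 ≤ (n : ℝ) ^ 2 * (2 * ((M : ℝ) + 1)⁻¹ + ε) := by positivity
    linarith

lemma tendsto_measure_close [∀ n, IsProbabilityMeasure (P n)] {μ : ProbabilityMeasure I}
    (hν : TendstoInProb (fun n => P (n + 1)) (fun n ω => degreeDist (G (n + 1) ω)) μ)
    {ε : ℝ} (hε : 0 < ε) :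
    Tendsto (fun M => P (M + 1) {ω | volume.real
      (reflectedSet (degreeDist (G (M + 1) ω)) ∆ reflectedSet μ) ≤ ε}) atTop (𝓝 1) := by
  refine hν {ν | volume.real (reflectedSet ν ∆ reflectedSet μ) ≤ ε} ?_
  have h := (ENNReal.tendsto_toReal ENNReal.zero_ne_top).comp
    (tendsto_volume_symmDiff_reflectedSet μ)
  exact h.eventually (ge_mem_nhds hε)

end Sampling

end ThresholdLimit

end

/-! ### The main theorem. -/

theorem theorem6p2 {Ω : ℕ → Type*} [∀ n, MeasurableSpace (Ω n)]
    (P : ∀ n, Measure (Ω n)) [∀ n, IsProbabilityMeasure (P n)]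
    (G : ∀ n, Ω n → SimpleGraph (Fin n))
    (hmeas : ∀ n, 1 ≤ n → AEMeasurable (G n) (P n))
    (hthr : ∀ n, 1 ≤ n → ∀ᵐ ω ∂(P n), ThresholdLimit.IsThreshold (G n ω))
    (hexch : ∀ n, 1 ≤ n → ∀ π : Equiv.Perm (Fin n),
      IdentDistrib (fun ω => (G n ω).map π.toEmbedding) (G n) (P n) (P n))
    (hcons : ∀ n, 1 ≤ n →
      IdentDistrib (fun ω => (G (n + 1) ω).comap Fin.castSucc) (G n) (P (n + 1)) (P n))
    (μ : ProbabilityMeasure I)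
    (hν : ThresholdLimit.TendstoInProb (fun n => P (n + 1))
      (fun n ω => ThresholdLimit.degreeDist (G (n + 1) ω)) μ) :
    μ ∈ ThresholdLimit.symmetricMeasures ∧
      ∀ n, 1 ≤ n →
        IdentDistrib (G n) (ThresholdLimit.pointGraph (ThresholdLimit.thresholdSet μ))
          (P n) (ThresholdLimit.uniformPoints n) := by
  open ThresholdLimit in
  have hinv : Tendsto (fun M : ℕ => ((M : ℝ) + 1)⁻¹) atTop (𝓝 0) := by
    simpa using tendsto_one_div_add_atTop_nhds_zero_nat (𝕜 := ℝ)
  refine ⟨?_, fun n hn => ?_⟩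
  · refine mem_symmetricMeasures_of_volume_eq_zero ?_
    rw [← measureReal_eq_zero_iff (measure_ne_top _ _)]
    refine le_antisymm (le_of_forall_pos_le_add fun ε hε => ?_) measureReal_nonneg
    -- The constants are chosen so that 2 (2 · ε/8 + ε/4) = ε. A single outcome suffices, since the
    -- conclusion about μ is deterministic.
    have hpos := (tendsto_measure_close hν (ε := ε / 4) (by positivity)).eventually
      (lt_mem_nhds zero_lt_one)
    obtain ⟨M, hM, hMε⟩ :=
      (hpos.and (hinv.eventually (gt_mem_nhds (show (0 : ℝ) < ε / 8 by positivity)))).exists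
    obtain ⟨ω, hω1, hω2⟩ := ((frequently_ae_iff.2 hM.ne').and_eventually
      (hthr (M + 1) (by omega))).exists
    have h := ENNReal.toReal_mono (by finiteness) (hω2.volume_symmDiff_le μ)
    rw [ENNReal.toReal_mul, ENNReal.toReal_add (by finiteness) (by finiteness),
      ENNReal.toReal_mul, ENNReal.toReal_inv, ENNReal.toReal_add (by simp) (by simp),
      ENNReal.toReal_natCast, ENNReal.toReal_one, ENNReal.toReal_ofNat] at h
    rw [Measure.real] at hω1 ⊢
    linarith
  · have hpm := measurable_pointGraph (n := n) (measurableSet_thresholdSet μ)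
    refine ⟨hmeas n hn, hpm.aemeasurable, ?_⟩
    refine Measure.ext_of_singleton fun K => ?_
    rw [Measure.map_apply_of_aemeasurable (hmeas n hn) (measurableSet_singleton K),
      Measure.map_apply hpm (measurableSet_singleton K),
      ← ENNReal.toReal_eq_toReal_iff' (measure_ne_top _ _) (measure_ne_top _ _)]
    change (P n).real {ω | G n ω = K} =
      (uniformPoints n).real {u | pointGraph (thresholdSet μ) u = K}
    rw [← sub_eq_zero, ← abs_nonpos_iff]
    have hbound : ∀ ε : ℝ, 0 < ε → |(P n).real {ω | G n ω = K} -
        (uniformPoints n).real {u | pointGraph (thresholdSet μ) u = K}| ≤ (n : ℝ) ^ 2 * ε := by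
      intro ε hε
      have hcompl : Tendsto (fun M => (P (M + 1)).real {ω | volume.real
          (reflectedSet (degreeDist (G (M + 1) ω)) ∆ reflectedSet μ) ≤ ε}ᶜ) atTop (𝓝 0) := by
        have h1 := (ENNReal.tendsto_toReal ENNReal.one_ne_top).comp (tendsto_measure_close hν hε)
        have h2 := h1.const_sub 1
        rw [ENNReal.toReal_one, sub_self] at h2
        refine h2.congr fun M => ?_
        exact (probReal_compl_eq_one_sub₀ ((hmeas (M + 1) (by omega)).nullMeasurable
          (MeasurableSet.of_discrete (s := {H : SimpleGraph (Fin (M + 1)) |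
            volume.real (reflectedSet (degreeDist H) ∆ reflectedSet μ) ≤ ε})))).symm
      have hlim := (hinv.const_mul ((n : ℝ) ^ 2)).add
        (((((hinv.const_mul 2).add_const ε)).const_mul ((n : ℝ) ^ 2)).add hcompl)
      rw [mul_zero, mul_zero, zero_add, zero_add, add_zero] at hlim
      -- For fixed `ε`, letting M → ∞ removes the collision, grid and bad-event errors and leaves
      -- n²ε.
      refine ge_of_tendsto' hlim fun M => ?_
      exact (abs_sub_le _ (∫ ω, inducedDensity K (G (M + 1) ω) ∂P (M + 1)) _).trans
        (add_le_add (abs_integral_inducedDensity_sub_le hmeas hexch hcons hn K M)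
          (abs_integral_sub_le hmeas hthr K M μ hε.le))
    have hlim : Tendsto (fun ε : ℝ => (n : ℝ) ^ 2 * ε) (𝓝[>] 0) (𝓝 ((n : ℝ) ^ 2 * 0)) :=
      (tendsto_nhdsWithin_of_tendsto_nhds tendsto_id).const_mul _
    rw [mul_zero] at hlim
    exact ge_of_tendsto hlim (eventually_mem_nhdsWithin.mono hbound)
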